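/- **Model.** A *network* is a finite simple graph $G$ whose nodes carry pairwise distinct natural numbers as identifiers; $n$ is its number of nodes and $\Delta$ its maximum degree. In a (deterministic) LOCAL algorithm each node initially knows its identifier, its degree, its label, $n$ and $\Delta$; in each synchronous round it exchanges messages of unbounded size with its neighbours and performs arbitrary local computation, until it terminates with an output. The number of rounds is the number after which all nodes have terminated. **Theorem.** There exist a constant $c$, a LOCAL algorithm $\mathcal A$, and a function that assigns exactly one bit $\ell_G(v)$ of advice to each node $v$ of each $3$-colorable network $G$ (the advice may depend on the graph and on the identifiers), such that on every $3$-colorable network $G$ whose nodes are labelled with $\ell_G$ the algorithm $\mathcal A$ outputs a proper $3$-coloring of $G$ in at most $\Delta^{c}$ rounds. (That is, for the family of $3$-colorable graphs and the problem of computing a $3$-coloring there is a uniform fixed-length advice schema with $1$ bit per node and $\Delta^{O(1)}$ rounds.) Moreover, for every constant $D$, $3$-colorability has a locally checkable proof with $1$ bit per node on the graphs of maximum degree at most $D$: there are a constant $r$ and a distributed verifier that runs in at most $r$ rounds, in which each node initially knows only its identifier, its degree and its proof label, such that for every network $G$ of maximum degree at most $D$: if $G$ is $3$-colorable, then there is an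 assignment of one proof bit to each node for which all nodes accept; if $G$ is not $3$-colorable, then for every assignment of bit strings to the nodes at least one node rejects. -/

import Mathlib

/-- An instance of a distributed graph problem: a finite simple graph whose nodes carry pairwise
distinct identifiers. No bound on the identifiers is imposed, so in particular all identifier
ranges `{1, …, n ^ c}` are covered. -/
structure Network where
  V : Type
  [fintypeV : Fintype V]
  graph : SimpleGraph V
  id : V → ℕ
  id_injective : Function.Injective id

namespace Network

attribute [instance] Network.fintypeV

/-- The number of nodes. -/
def size (N : Network) : ℕ := Fintype.card N.V

open Classical in
/-- The neighbours of a node. -/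
noncomputable def nbrs (N : Network) (v : N.V) : Finset N.V := N.graph.neighborFinset v

/-- The degree of a node. -/
noncomputable def degree (N : Network) (v : N.V) : ℕ := (N.nbrs v).card

open Classical in
/-- The maximum degree of the graph (`0` for the empty graph). -/
noncomputable def maxDegree (N : Network) : ℕ := N.graph.maxDegree

end Network

/-- A synchronous deterministic message-passing algorithm. `In` is what a node knows at the start,
`Out` the type of outputs. A node has terminated as soon as `output` of its state is not `none`.
States and messages are of arbitrary type (unbounded messages) and the transition functions are
arbitrary (unbounded local computation). In a round a node sends the same message to all of its
neighbours and receives the multiset of the messages of its neighbours; a message may contain the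
identifiers of its sender and of its intended recipients. -/
structure LocalAlgorithm (In Out : Type) where
  State : Type
  Msg : Type
  init : In → State
  send : State → Msg
  update : State → Multiset Msg → State
  output : State → Option Out

namespace LocalAlgorithm

variable {In Out : Type}

open Classical in
/-- The state of each node after `t` rounds, where `x v` is the initial knowledge of node `v`.
A node that has terminated keeps its state and sends no more messages. -/
noncomputable def stateAfter (A : LocalAlgorithm In Out) (N : Network) (x : N.V → In) :
    ℕ → N.V → A.State
  | 0, v => A.init (x v)
  | t + 1, v =>
    if A.output (A.stateAfter N x t v) = none then
      A.update (A.stateAfter N x t v)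
        (((N.nbrs v).filter fun u => A.output (A.stateAfter N x t u) = none).val.map
          fun u => A.send (A.stateAfter N x t u))
    else A.stateAfter N x t v

/-- Within at most `T` rounds all nodes terminate, and node `v` outputs `out v`. -/
def Outputs (A : LocalAlgorithm In Out) (N : Network) (x : N.V → In) (T : ℕ)
    (out : N.V → Out) : Prop :=
  ∀ v, A.output (A.stateAfter N x T v) = some (out v)

end LocalAlgorithm

/-- What a node knows about itself: its identifier, its degree, and its label. -/
structure NodeInfo where
  id : ℕ
  degree : ℕ
  label : List Bool

/-- The initial knowledge of a node in the LOCAL model: in addition to the information about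
itself, the number of nodes and the maximum degree of the graph. -/
structure LocalInfo extends NodeInfo where
  size : ℕ
  maxDegree : ℕ

namespace Network

/-- The node information when the nodes are labelled with the bit strings `ℓ`. -/
noncomputable def nodeInfo (N : Network) (ℓ : N.V → List Bool) (v : N.V) : NodeInfo where
  id := N.id v
  degree := N.degree v
  label := ℓ v

/-- The initial knowledge in the LOCAL model when the nodes are labelled with the bit strings
`ℓ`. -/
noncomputable def localInfo (N : Network) (ℓ : N.V → List Bool) (v : N.V) : LocalInfo where
  toNodeInfo := N.nodeInfo ℓ v
  size := N.size
  maxDegree := N.maxDegree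

end Network

/-- A graph problem in which each node has to output an element of `Out`. -/
structure GraphProblem where
  Out : Type
  Valid : (N : Network) → (N.V → Out) → Prop

/-- Proper vertex 3-colouring. -/
abbrev threeColoring : GraphProblem where
  Out := Fin 3
  Valid N out := ∀ u v, N.graph.Adj u v → out u ≠ out v

/-- `f` is a `(𝒢, P, β, T)`-advice schema: it assigns to each node of each network in the family
`𝒢` a bit string of length at most `β(Δ)`, in such a way that a single LOCAL algorithm that is given
these strings outputs, in at most `T(Δ)` rounds, a valid solution of `P` on each network in `𝒢`. -/
structure IsAdviceSchema (𝒢 : Set Network) (P : GraphProblem) (β T : ℕ → ℕ)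
    (f : (N : Network) → N.V → List Bool) : Prop where
  length_le : ∀ N ∈ 𝒢, ∀ v, (f N v).length ≤ β N.maxDegree
  solves : ∃ A : LocalAlgorithm LocalInfo P.Out, ∀ N ∈ 𝒢, ∃ out : N.V → P.Out,
    A.Outputs N (N.localInfo (f N)) (T N.maxDegree) out ∧ P.Valid N out

/-- A uniform fixed-length advice schema: all nodes receive bit strings of the same length, namely
of length exactly `β(Δ)`. -/
structure IsUniformAdviceSchema (𝒢 : Set Network) (P : GraphProblem) (β T : ℕ → ℕ)
    (f : (N : Network) → N.V → List Bool) : Prop extends IsAdviceSchema 𝒢 P β T f where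
  length_eq : ∀ N ∈ 𝒢, ∀ v, (f N v).length = β N.maxDegree

/-- The property `Q` has, on the family `𝒢`, a locally checkable proof with `b` bits per node:
there is a distributed verifier with a constant number `r` of rounds, in which a node initially
knows only its identifier, its degree and its proof label, such that on networks with property `Q`
there is a proof with `b` bits per node that all nodes accept, while on networks without
property `Q` every proof is rejected by some node. -/
def HasLocallyCheckableProof (𝒢 : Set Network) (Q : Network → Prop) (b : ℕ) : Prop :=
  ∃ (A : LocalAlgorithm NodeInfo Bool) (r : ℕ), ∀ N ∈ 𝒢,
    (∀ p : N.V → List Bool, ∃ out, A.Outputs N (N.nodeInfo p) r out) ∧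
    (Q N → ∃ p : N.V → List Bool, (∀ v, (p v).length = b) ∧
      A.Outputs N (N.nodeInfo p) r fun _ => true) ∧
    (¬ Q N → ∀ (p : N.V → List Bool) (out : N.V → Bool),
      A.Outputs N (N.nodeInfo p) r out → ∃ v, out v = false)

/-! Fix a 3-colouring with as many nodes of colour `0` as possible, so that every other node has a
neighbour of colour `0`. The bits mark colour `0`; what remains is to split the bipartite graph
`rest` into colours `1` and `2`. A component without a path of length `L` has radius at most `L`, so
its nodes all find its smallest identifier and use the parity of the distance to it. In the other
components a few extra marks serve as roots for the parity.

Extra marks must be told apart from colour `0`. They are placed on gadgets: a node with two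
neighbours of colour `0`, or an edge without a common neighbour of colour `0`. If distinct gadgets
are at distance more than two, a node of colour `0` has at most one marked neighbour, whereas every
gadget node has at least two (`extra_gadgetMarks`). Gadgets abound, because a path of more than `D`
nodes without one would have all its nodes adjacent to the same node (`exists_isGadget_of_path`).

A root also has to reveal its own colour: it is `1` if no other root is within `2 * L`, and `2` if
there is one. Accordingly, each of a family of well-separated centres (`exists_centres`) gets one
gadget with a root of colour `1` or two with roots of colour `2`. All of them are chosen from long
candidate lists, simultaneously and without conflicts, by `exists_independent_transversal`. Then the
decoded colouring is proper (`color_gadgetMarks_ne`).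

Decoding looks only at radius `7 * L + 2` (`MarkedGraph.color_eq`), so a node can do it after
gathering its neighbourhood. For the locally checkable proof every node decodes and compares its
colour with its neighbours. -/

/-! ### Independent transversals by counting. -/

open Classical in
/-- If every part has `m ≥ 4 * d` candidates and every candidate is in conflict with at most `d`
candidates, then one can choose a candidate from each part without conflicts. -/
theorem exists_independent_transversal {ι : Type*} [Fintype ι] {m d : ℕ} (hm : 4 * d ≤ m)
    (hm0 : 0 < m) (C : ι × Fin m → ι × Fin m → Prop) (hsymm : ∀ a b, C a b → C b a)
    (hC : ∀ a, (Finset.univ.filter (C a)).card ≤ d) :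
    ∃ f : ι → Fin m, ∀ i j, i ≠ j → ¬ C (i, f i) (j, f j) := by
  -- Functions are frozen to `z` outside `S`, so that `T S` counts partial choices on `S`.
  set z : Fin m := ⟨0, hm0⟩
  let T : Finset ι → Finset (ι → Fin m) := fun S => Finset.univ.filter fun f =>
    (∀ i, i ∉ S → f i = z) ∧ ∀ i ∈ S, ∀ j ∈ S, i ≠ j → ¬ C (i, f i) (j, f j)
  have memT : ∀ S f, f ∈ T S ↔ (∀ i, i ∉ S → f i = z) ∧
      ∀ i ∈ S, ∀ j ∈ S, i ≠ j → ¬ C (i, f i) (j, f j) := by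
    intro S f; simp [T]
  -- A pair `(x, f)` either extends `f` to `insert i S` or meets a conflict at some `b` with `f b.1
  -- = b.2`. In the second case `f` can be recovered from `b` and its restriction to `S.erase b.1`.
  have ext : ∀ S i, i ∉ S → m * (T S).card ≤ (T (insert i S)).card +
      ∑ x : Fin m, ∑ b ∈ Finset.univ.filter (fun b => C (i, x) b ∧ b.1 ∈ S),
        (T (S.erase b.1)).card := by
    intro S i hi
    let P := (Finset.univ : Finset (Fin m)) ×ˢ T S
    let good : Fin m × (ι → Fin m) → Prop := fun q => ∀ j ∈ S, ¬ C (i, q.1) (j, q.2 j)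
    have hP : P.card = m * (T S).card := by simp [P]
    rw [← hP, ← Finset.card_filter_add_card_filter_not (s := P) good]
    apply Nat.add_le_add
    · apply Finset.card_le_card_of_injOn (fun q => Function.update q.2 i q.1)
      · rintro ⟨x, f⟩ hq
        simp only [Finset.coe_filter, Set.mem_ofPred_eq, P, Finset.mem_product, memT, good] at hq
        obtain ⟨⟨-, h1, h2⟩, h3⟩ := hq
        simp only [Finset.mem_coe, memT]
        refine ⟨fun k hk => ?_, fun k hk l hl hkl => ?_⟩
        · rw [Finset.mem_insert, not_or] at hk
          rw [Function.update_of_ne hk.1]; exact h1 k hk.2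
        · rw [Finset.mem_insert] at hk hl
          rcases eq_or_ne k i with rfl | hki
          · have hlk : l ≠ k := hkl.symm
            have hlS : l ∈ S := hl.resolve_left hlk
            rw [Function.update_self, Function.update_of_ne hlk]
            exact h3 l hlS
          · rw [Function.update_of_ne hki]
            rcases eq_or_ne l i with rfl | hli
            · rw [Function.update_self]
              exact fun h => h3 k (hk.resolve_left hki) (hsymm _ _ h)
            · rw [Function.update_of_ne hli]
              exact h2 k (hk.resolve_left hki) l (hl.resolve_left hli) hkl
      · rintro ⟨x, f⟩ hq ⟨x', f'⟩ hq' h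
        simp only [Finset.coe_filter, Set.mem_ofPred_eq, P, Finset.mem_product, memT, good] at hq hq'
        have hx : x = x' := by simpa using congrFun h i
        subst hx
        have : f = f' := by
          funext k
          rcases eq_or_ne k i with rfl | hki
          · rw [hq.1.2.1 k hi, hq'.1.2.1 k hi]
          · have := congrFun h k
            simpa [Function.update_of_ne hki] using this
        rw [this]
    · let U : Finset (Fin m × (ι → Fin m)) := (Finset.univ : Finset (Fin m)).biUnion fun x =>
        (Finset.univ.filter (fun b => C (i, x) b ∧ b.1 ∈ S)).biUnion fun b =>
          (((T S).filter fun f => f b.1 = b.2).image fun f => (x, f))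
      have hU : P.filter (fun q => ¬ good q) ⊆ U := by
        rintro ⟨x, f⟩ hq
        simp only [Finset.mem_filter, P, Finset.mem_product, good, not_forall, not_not] at hq
        obtain ⟨⟨-, hf⟩, j, hj, hc⟩ := hq
        simp only [U, Finset.mem_biUnion, Finset.mem_image, Finset.mem_filter, Finset.mem_univ,
          true_and]
        exact ⟨x, (j, f j), ⟨hc, hj⟩, f, ⟨hf, rfl⟩, rfl⟩
      refine (Finset.card_le_card hU).trans (Finset.card_biUnion_le.trans ?_)
      refine Finset.sum_le_sum fun x _ => Finset.card_biUnion_le.trans ?_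
      refine Finset.sum_le_sum fun b hb => Finset.card_image_le.trans ?_
      simp only [Finset.mem_filter, Finset.mem_univ, true_and] at hb
      apply Finset.card_le_card_of_injOn (fun f => Function.update f b.1 z)
      · intro f hf
        simp only [Finset.coe_filter, Set.mem_ofPred_eq, memT] at hf
        obtain ⟨⟨h1, h2⟩, -⟩ := hf
        simp only [Finset.mem_coe, memT]
        refine ⟨fun k hk => ?_, fun k hk l hl hkl => ?_⟩
        · rcases eq_or_ne k b.1 with rfl | hkb
          · simp
          · rw [Function.update_of_ne hkb]
            exact h1 k fun h => hk (Finset.mem_erase.2 ⟨hkb, h⟩)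
        · rw [Finset.mem_erase] at hk hl
          rw [Function.update_of_ne hk.1, Function.update_of_ne hl.1]
          exact h2 k hk.2 l hl.2 hkl
      · intro f hf f' hf' h
        simp only [Finset.coe_filter, Set.mem_ofPred_eq] at hf hf'
        funext k
        rcases eq_or_ne k b.1 with rfl | hkb
        · rw [hf.2, hf'.2]
        · have := congrFun h k
          simpa [Function.update_of_ne hkb] using this
  -- Each new part multiplies the count by at least `m / 2`. By induction each of the at most `m *
  -- d` conflict terms is at most `2 / m` times `(T S).card`, so together they cost at most `2 * d *
  -- (T S).card`, half of all extensions.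
  have step : ∀ n S, S.card = n → ∀ i, i ∉ S → m * (T S).card ≤ 2 * (T (insert i S)).card := by
    intro n
    induction n using Nat.strong_induction_on with
    | _ n ih =>
      intro S hS i hi
      have h1 := ext S i hi
      set Q := ∑ x : Fin m, ∑ b ∈ Finset.univ.filter (fun b => C (i, x) b ∧ b.1 ∈ S),
        (T (S.erase b.1)).card with hQ
      have h2 : m * Q ≤ m * (d * (2 * (T S).card)) := by
        rw [hQ, Finset.mul_sum]
        have : ∀ x ∈ (Finset.univ : Finset (Fin m)),
            m * ∑ b ∈ Finset.univ.filter (fun b => C (i, x) b ∧ b.1 ∈ S),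
              (T (S.erase b.1)).card ≤ d * (2 * (T S).card) := by
          intro x _
          rw [Finset.mul_sum]
          refine (Finset.sum_le_card_nsmul _ _ (2 * (T S).card) fun b hb => ?_).trans ?_
          · simp only [Finset.mem_filter, Finset.mem_univ, true_and] at hb
            have hlt : (S.erase b.1).card < n := by
              rw [← hS]; exact Finset.card_erase_lt_of_mem hb.2
            have := ih _ hlt (S.erase b.1) rfl b.1 (Finset.notMem_erase _ _)
            rwa [Finset.insert_erase hb.2] at this
          · rw [smul_eq_mul]
            refine Nat.mul_le_mul_right _ ((Finset.card_le_card ?_).trans (hC (i, x)))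
            intro b hb
            simp only [Finset.mem_filter, Finset.mem_univ, true_and] at hb ⊢
            exact hb.1
        refine (Finset.sum_le_card_nsmul _ _ _ this).trans ?_
        simp
      have h3 : Q ≤ d * (2 * (T S).card) := Nat.le_of_mul_le_mul_left h2 hm0
      have h4 : 4 * d * (T S).card ≤ m * (T S).card := Nat.mul_le_mul_right _ hm
      nlinarith
  have pos : ∀ S, 0 < (T S).card := by
    intro S
    induction S using Finset.induction_on with
    | empty =>
      refine Finset.card_pos.2 ⟨fun _ => z, ?_⟩
      rw [memT]; simp
    | insert i S hi ih =>
      have := step _ S rfl i hi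
      have : 0 < m * (T S).card := Nat.mul_pos hm0 ih
      omega
  obtain ⟨f, hf⟩ := Finset.card_pos.1 (pos Finset.univ)
  rw [memT] at hf
  exact ⟨f, fun i j => hf.2 i (Finset.mem_univ _) j (Finset.mem_univ _)⟩

/-! ### The decoder. -/

/-- A graph with marked nodes and node identifiers; also used for the part of such a graph that a
node knows, where `adj` need not be symmetric. -/
structure MarkedGraph (V : Type) where
  adj : V → V → Prop
  mark : V → Prop
  id : V → ℕ

namespace MarkedGraph

section Decoder

variable {V : Type} (M : MarkedGraph V)

/-- A marked node with at least two marked neighbours. -/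
def Extra (v : V) : Prop :=
  M.mark v ∧ ∃ y z, y ≠ z ∧ M.adj v y ∧ M.adj v z ∧ M.mark y ∧ M.mark z

/-- The marked nodes that are to receive the first colour. -/
def Base (v : V) : Prop := M.mark v ∧ ¬ M.Extra v

/-- Adjacency in the graph without the nodes of the first colour. -/
def RestAdj (u v : V) : Prop := M.adj u v ∧ ¬ M.Base u ∧ ¬ M.Base v

/-- There is a walk of length `k` that avoids the nodes of the first colour. -/
def Reach : ℕ → V → V → Prop
  | 0, u, v => u = v
  | k + 1, u, v => ∃ w, M.RestAdj u w ∧ Reach k w v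

/-- An extra node whose identifier is smaller than those of its extra neighbours. -/
def Root (x : V) : Prop := M.Extra x ∧ ∀ y, M.adj x y → M.Extra y → M.id x < M.id y

/-- There is another root nearby. -/
def Flipped (L : ℕ) (x : V) : Prop :=
  ∃ k ≤ 2 * L, ∃ y, M.Reach k x y ∧ M.Root y ∧ M.id y ≠ M.id x

/-- There is a root nearby. -/
def HasRoot (L : ℕ) (v : V) : Prop := ∃ k ≤ 5 * L, ∃ x, M.Reach k v x ∧ M.Root x

/-- A root nearby assigns the second colour to `v`. -/
def RootSecond (L : ℕ) (v : V) : Prop :=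
  ∃ k ≤ 5 * L, ∃ x, M.Reach k v x ∧ M.Root x ∧ (Even k ↔ ¬ M.Flipped L x)

/-- The node with the smallest identifier nearby is at even distance from `v`. -/
def MinSecond (L : ℕ) (v : V) : Prop :=
  ∃ k ≤ 5 * L, ∃ x, M.Reach k v x ∧ Even k ∧
    ∀ j ≤ 5 * L, ∀ y, M.Reach j v y → M.id x ≤ M.id y

/-- The node `v` is to receive the second colour if it does not receive the first one. -/
def Second (L : ℕ) (v : V) : Prop :=
  (M.HasRoot L v ∧ M.RootSecond L v) ∨ (¬ M.HasRoot L v ∧ M.MinSecond L v)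

open Classical in
/-- The colour of a node that is decoded from the marks. -/
noncomputable def color (L : ℕ) (v : V) : Fin 3 :=
  if M.Base v then 0 else if M.Second L v then 1 else 2

end Decoder

/-! ### Decoding depends only on a bounded neighbourhood. -/

section Locality

variable {V : Type}

/-- All marks and edges recorded in `W` are present in `M`. -/
def Sound (M : MarkedGraph V) (W : MarkedGraph ℕ) : Prop :=
  (∀ i j, W.adj i j → ∃ u v, M.adj u v ∧ M.id u = i ∧ M.id v = j) ∧
    ∀ i, W.mark i → ∃ u, M.mark u ∧ M.id u = i

/-- The mark and the edges of `M` at `v` are recorded in `W`. -/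
def KnownAt (M : MarkedGraph V) (W : MarkedGraph ℕ) (v : V) : Prop :=
  (M.mark v → W.mark (M.id v)) ∧ ∀ u, M.adj v u → W.adj (M.id v) (M.id u)

/-- All marks and edges of `M` at nodes at distance at most `r` from `v` are recorded in `W`. -/
def Known (M : MarkedGraph V) (W : MarkedGraph ℕ) (r : ℕ) (v : V) : Prop :=
  match r with
  | 0 => M.KnownAt W v
  | r + 1 => M.KnownAt W v ∧ ∀ u, M.adj v u → Known M W r u

variable {M : MarkedGraph V} {W : MarkedGraph ℕ}

theorem known_succ {r : ℕ} {v : V} :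
    M.Known W (r + 1) v ↔ M.KnownAt W v ∧ ∀ u, M.adj v u → M.Known W r u := Iff.rfl

theorem Known.knownAt {r : ℕ} {v : V} (h : M.Known W r v) : M.KnownAt W v := by
  cases r with
  | zero => exact h
  | succ r => exact (known_succ.1 h).1

theorem Known.adj {r : ℕ} {v u : V} (h : M.Known W r v) (hu : M.adj v u) :
    W.adj (M.id v) (M.id u) := h.knownAt.2 u hu

theorem Known.next {r : ℕ} {v u : V} (h : M.Known W (r + 1) v) (hu : M.adj v u) :
    M.Known W r u := (known_succ.1 h).2 u hu

theorem Known.of_succ {r : ℕ} : ∀ {v : V}, M.Known W (r + 1) v → M.Known W r v := by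
  induction r with
  | zero => exact fun h => h.knownAt
  | succ r ih => exact fun h => known_succ.2 ⟨h.knownAt, fun u hu => ih (h.next hu)⟩

theorem Known.mono {r s : ℕ} (hrs : r ≤ s) {v : V} (h : M.Known W s v) : M.Known W r v := by
  induction hrs with
  | refl => exact h
  | step _ ih => exact ih h.of_succ

theorem Known.mono_right {W' : MarkedGraph ℕ} (hadj : ∀ i j, W.adj i j → W'.adj i j)
    (hmark : ∀ i, W.mark i → W'.mark i) {r : ℕ} :
    ∀ {v : V}, M.Known W r v → M.Known W' r v := by
  have base : ∀ {v : V}, M.KnownAt W v → M.KnownAt W' v := fun h =>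
    ⟨fun hv => hmark _ (h.1 hv), fun u hu => hadj _ _ (h.2 u hu)⟩
  induction r with
  | zero => exact base
  | succ r ih =>
    intro v h
    exact known_succ.2 ⟨base h.knownAt, fun u hu => ih (h.next hu)⟩

variable (hS : M.Sound W) (hinj : Function.Injective M.id) (hW : ∀ i, W.id i = i)

include hS hinj

theorem mark_iff {r : ℕ} {v : V} (h : M.Known W r v) : W.mark (M.id v) ↔ M.mark v := by
  refine ⟨fun hv => ?_, h.knownAt.1⟩
  obtain ⟨u, hu, huv⟩ := hS.2 _ hv
  rwa [← hinj huv]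

/-- Views use identifiers as nodes. Soundness excludes invented edges, knowledge excludes missing
ones, and injectivity ties the identifier back to `v`. -/
theorem adj_iff {r : ℕ} {v : V} (h : M.Known W r v) (j : ℕ) :
    W.adj (M.id v) j ↔ ∃ u, M.adj v u ∧ M.id u = j := by
  constructor
  · intro hv
    obtain ⟨u, w, huw, hu, hw⟩ := hS.1 _ _ hv
    exact ⟨w, hinj hu ▸ huw, hw⟩
  · rintro ⟨u, hu, rfl⟩
    exact h.adj hu

theorem extra_iff {r : ℕ} {v : V} (h : M.Known W (r + 1) v) :
    W.Extra (M.id v) ↔ M.Extra v := by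
  unfold Extra
  rw [mark_iff hS hinj h]
  refine and_congr_right fun _ => ⟨?_, ?_⟩
  · rintro ⟨y', z', hyz, hy', hz', my, mz⟩
    obtain ⟨y, hy, rfl⟩ := (adj_iff hS hinj h _).1 hy'
    obtain ⟨z, hz, rfl⟩ := (adj_iff hS hinj h _).1 hz'
    exact ⟨y, z, fun e => hyz (e ▸ rfl), hy, hz, (mark_iff hS hinj (h.next hy)).1 my,
      (mark_iff hS hinj (h.next hz)).1 mz⟩
  · rintro ⟨y, z, hyz, hy, hz, my, mz⟩
    exact ⟨M.id y, M.id z, fun e => hyz (hinj e), h.adj hy, h.adj hz,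
      (mark_iff hS hinj (h.next hy)).2 my, (mark_iff hS hinj (h.next hz)).2 mz⟩

theorem base_iff {r : ℕ} {v : V} (h : M.Known W (r + 1) v) : W.Base (M.id v) ↔ M.Base v := by
  unfold Base
  rw [mark_iff hS hinj h, extra_iff hS hinj h]

theorem restAdj_iff {r : ℕ} {v : V} (h : M.Known W (r + 2) v) (j : ℕ) :
    W.RestAdj (M.id v) j ↔ ∃ u, M.RestAdj v u ∧ M.id u = j := by
  unfold RestAdj
  constructor
  · rintro ⟨ha, hv, hj⟩
    obtain ⟨u, hu, rfl⟩ := (adj_iff hS hinj h _).1 ha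
    exact ⟨u, ⟨hu, mt (base_iff hS hinj h).2 hv, mt (base_iff hS hinj (h.next hu)).2 hj⟩, rfl⟩
  · rintro ⟨u, ⟨hu, hv, hj⟩, rfl⟩
    exact ⟨h.adj hu, mt (base_iff hS hinj h).1 hv, mt (base_iff hS hinj (h.next hu)).1 hj⟩

omit hS hinj in
theorem Known.of_reach {r k : ℕ} : ∀ {v u : V}, M.Known W (r + k) v → M.Reach k v u →
    M.Known W r u := by
  induction k with
  | zero => rintro v u h rfl; exact h
  | succ k ih =>
    rintro v u h ⟨w, hw, hwu⟩
    exact ih (h.next hw.1) hwu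

theorem reach_iff {k : ℕ} : ∀ {v : V}, M.Known W (k + 2) v → ∀ j,
    (W.Reach k (M.id v) j ↔ ∃ u, M.Reach k v u ∧ M.id u = j) := by
  induction k with
  | zero => intro v _ j; simp [Reach]
  | succ k ih =>
    intro v h j
    constructor
    · rintro ⟨w', hw', hwj⟩
      obtain ⟨w, hw, rfl⟩ := (restAdj_iff hS hinj (r := k + 1) h _).1 hw'
      obtain ⟨u, hu, rfl⟩ := (ih (h.next hw.1) j).1 hwj
      exact ⟨u, ⟨w, hw, hu⟩, rfl⟩
    · rintro ⟨u, ⟨w, hw, hu⟩, rfl⟩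
      exact ⟨M.id w, (restAdj_iff hS hinj (r := k + 1) h _).2 ⟨w, hw, rfl⟩,
        (ih (h.next hw.1) _).2 ⟨u, hu, rfl⟩⟩

/-- The common form of the decoding predicates: the radii of the walk and of the test at its end add
up. -/
theorem exists_reach_iff {r k : ℕ} {v : V} (h : M.Known W (r + k + 2) v) {P : ℕ → Prop}
    {Q : V → Prop} (hPQ : ∀ u, M.Known W (r + 2) u → (P (M.id u) ↔ Q u)) :
    (∃ j, W.Reach k (M.id v) j ∧ P j) ↔ ∃ u, M.Reach k v u ∧ Q u := by
  have hk : M.Known W (k + 2) v := h.mono (by omega)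
  have hr : ∀ u, M.Reach k v u → M.Known W (r + 2) u := fun u hu =>
    Known.of_reach (k := k) (h.mono (by omega)) hu
  constructor
  · rintro ⟨j, hj, hP⟩
    obtain ⟨u, hu, rfl⟩ := (reach_iff hS hinj hk j).1 hj
    exact ⟨u, hu, (hPQ u (hr u hu)).1 hP⟩
  · rintro ⟨u, hu, hQ⟩
    exact ⟨M.id u, (reach_iff hS hinj hk _).2 ⟨u, hu, rfl⟩, (hPQ u (hr u hu)).2 hQ⟩

include hW

theorem root_iff {r : ℕ} {v : V} (h : M.Known W (r + 2) v) : W.Root (M.id v) ↔ M.Root v := by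
  unfold Root
  rw [extra_iff hS hinj h]
  refine and_congr_right fun _ => ⟨fun H y hy ey => ?_, fun H y' hy' ey => ?_⟩
  · simpa only [hW] using H (M.id y) (h.adj hy) ((extra_iff hS hinj (h.next hy)).2 ey)
  · obtain ⟨y, hy, rfl⟩ := (adj_iff hS hinj h _).1 hy'
    simpa only [hW] using H y hy ((extra_iff hS hinj (h.next hy)).1 ey)

theorem flipped_iff {L : ℕ} {v : V} (h : M.Known W (2 * L + 2) v) :
    W.Flipped L (M.id v) ↔ M.Flipped L v := by
  unfold Flipped
  refine exists_congr fun k => and_congr_right fun hk => ?_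
  refine exists_reach_iff hS hinj (r := 0) (h.mono (by omega)) fun u hu => ?_
  rw [root_iff hS hinj hW hu, hW, hW]

theorem hasRoot_iff {L : ℕ} {v : V} (h : M.Known W (5 * L + 2) v) :
    W.HasRoot L (M.id v) ↔ M.HasRoot L v := by
  unfold HasRoot
  refine exists_congr fun k => and_congr_right fun hk => ?_
  exact exists_reach_iff hS hinj (r := 0) (h.mono (by omega)) fun u hu =>
    root_iff hS hinj hW hu

/-- The radius is `5 * L` to reach a root, `2 * L` from there to look for a second root, and `2` to
recognize that one as a root. -/
theorem rootSecond_iff {L : ℕ} {v : V} (h : M.Known W (7 * L + 2) v) :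
    W.RootSecond L (M.id v) ↔ M.RootSecond L v := by
  unfold RootSecond
  refine exists_congr fun k => and_congr_right fun hk => ?_
  refine exists_reach_iff hS hinj (r := 2 * L) (h.mono (by omega)) fun u hu => ?_
  rw [root_iff hS hinj hW hu, flipped_iff hS hinj hW hu]

theorem minSecond_iff {L : ℕ} {v : V} (h : M.Known W (5 * L + 2) v) :
    W.MinSecond L (M.id v) ↔ M.MinSecond L v := by
  unfold MinSecond
  refine exists_congr fun k => and_congr_right fun hk => ?_
  refine exists_reach_iff hS hinj (r := 0) (h.mono (by omega)) fun u hu => ?_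
  refine and_congr_right fun _ => forall_congr' fun j => forall_congr' fun hj => ?_
  have hj2 : M.Known W (j + 2) v := h.mono (by omega)
  constructor
  · intro H y hy
    simpa only [hW] using H (M.id y) ((reach_iff hS hinj hj2 _).2 ⟨y, hy, rfl⟩)
  · intro H y' hy'
    obtain ⟨y, hy, rfl⟩ := (reach_iff hS hinj hj2 _).1 hy'
    simpa only [hW] using H y hy

theorem second_iff {L : ℕ} {v : V} (h : M.Known W (7 * L + 2) v) :
    W.Second L (M.id v) ↔ M.Second L v := by
  have h5 : M.Known W (5 * L + 2) v := h.mono (by omega)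
  unfold Second
  rw [hasRoot_iff hS hinj hW h5, rootSecond_iff hS hinj hW h, minSecond_iff hS hinj hW h5]

theorem color_eq {L : ℕ} {v : V} (h : M.Known W (7 * L + 2) v) :
    W.color L (M.id v) = M.color L v := by
  unfold color
  rw [propext (base_iff hS hinj (r := 7 * L + 1) h), propext (second_iff hS hinj hW h)]

end Locality

end MarkedGraph

/-! ### Gathering neighbourhoods in the LOCAL model. -/

namespace LocalAlgorithm

/-- The state of a node that collects everything it can learn about its neighbourhood. -/
structure GatherState (In : Type) where
  info : In
  time : ℕ
  view : MarkedGraph ℕ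

/-- The algorithm that collects information for `T` rounds and then applies `fin`. -/
def gather {In Out : Type} (node : In → NodeInfo) (T : In → ℕ)
    (fin : In → MarkedGraph ℕ → Out) : LocalAlgorithm In Out where
  State := GatherState In
  Msg := GatherState In
  init x := ⟨x, 0, fun _ _ => False, fun i => i = (node x).id ∧ (node x).label = [true], fun i => i⟩
  send s := s
  update s ms := ⟨s.info, s.time + 1,
    fun i j => s.view.adj i j ∨ (∃ m ∈ ms, i = (node s.info).id ∧ j = (node m.info).id) ∨
      ∃ m ∈ ms, m.view.adj i j,
    fun i => s.view.mark i ∨ ∃ m ∈ ms, m.view.mark i, fun i => i⟩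
  output s := if T s.info ≤ s.time then some (fin s.info s.view) else none

variable {In Out : Type} (node : In → NodeInfo) (T : In → ℕ) (fin : In → MarkedGraph ℕ → Out)
  (N : Network) (x : N.V → In)

/-- A network with nodes marked by the label `[true]`. -/
def _root_.Network.marked (N : Network) (ℓ : N.V → List Bool) : MarkedGraph N.V where
  adj := N.graph.Adj
  mark v := ℓ v = [true]
  id := N.id

theorem _root_.Network.mem_nbrs {N : Network} {u v : N.V} : u ∈ N.nbrs v ↔ N.graph.Adj v u := by
  classical
  simp [Network.nbrs]

/-- The view of a node after `t` rounds of gathering. -/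
noncomputable def gatherView (t : ℕ) (v : N.V) : MarkedGraph ℕ :=
  ((gather node T fin).stateAfter N x t v).view

variable {node T fin N x}

theorem gather_state {T₀ : ℕ} (hT : ∀ v, T (x v) = T₀) {t : ℕ} (ht : t ≤ T₀) :
    ∀ v, ((gather node T fin).stateAfter N x t v).info = x v ∧
      ((gather node T fin).stateAfter N x t v).time = t := by
  induction t with
  | zero => exact fun v => ⟨rfl, rfl⟩
  | succ t ih =>
    intro v
    obtain ⟨h1, h2⟩ := ih (by omega) v
    have : (gather node T fin).output ((gather node T fin).stateAfter N x t v) = none := by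
      simp only [gather] at h1 h2 ⊢
      rw [h1, h2, hT, if_neg (by omega)]
    rw [stateAfter, if_pos this]
    exact ⟨h1, congrArg (· + 1) h2⟩

theorem gather_output_none {T₀ : ℕ} (hT : ∀ v, T (x v) = T₀) {t : ℕ} (ht : t < T₀) (v : N.V) :
    (gather node T fin).output ((gather node T fin).stateAfter N x t v) = none := by
  obtain ⟨h1, h2⟩ := gather_state (node := node) (fin := fin) hT ht.le v
  change (if T _ ≤ _ then _ else _) = _
  rw [h1, h2, hT, if_neg (by omega)]

/-- All nodes share the deadline `T₀`, so no neighbour has fallen silent before it and the filter on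
messages is vacuous. -/
theorem gather_update {T₀ : ℕ} (hT : ∀ v, T (x v) = T₀) {t : ℕ} (ht : t < T₀) (v : N.V) :
    (gather node T fin).stateAfter N x (t + 1) v =
      (gather node T fin).update ((gather node T fin).stateAfter N x t v)
        ((N.nbrs v).val.map fun u => (gather node T fin).stateAfter N x t u) := by
  rw [stateAfter, if_pos (gather_output_none hT ht v)]
  have : (N.nbrs v).filter (fun u => (gather node T fin).output
      ((gather node T fin).stateAfter N x t u) = none) = N.nbrs v :=
    Finset.filter_true_of_mem fun u _ => gather_output_none hT ht u
  rw [this]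
  rfl

theorem gatherView_adj {T₀ : ℕ} (hT : ∀ v, T (x v) = T₀) {t : ℕ} (ht : t < T₀) (v : N.V)
    (i j : ℕ) : (gatherView node T fin N x (t + 1) v).adj i j ↔
      (gatherView node T fin N x t v).adj i j ∨
      (∃ u, N.graph.Adj v u ∧ i = (node (x v)).id ∧ j = (node (x u)).id) ∨
      ∃ u, N.graph.Adj v u ∧ (gatherView node T fin N x t u).adj i j := by
  unfold gatherView
  rw [gather_update hT ht]
  have h := fun u => (gather_state (node := node) (fin := fin) hT ht.le u).1
  simp only [gather, Multiset.mem_map, Finset.mem_val, Network.mem_nbrs,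
    exists_exists_and_eq_and] at h ⊢
  simp only [h]

theorem gatherView_mark {T₀ : ℕ} (hT : ∀ v, T (x v) = T₀) {t : ℕ} (ht : t < T₀) (v : N.V)
    (i : ℕ) : (gatherView node T fin N x (t + 1) v).mark i ↔
      (gatherView node T fin N x t v).mark i ∨
      ∃ u, N.graph.Adj v u ∧ (gatherView node T fin N x t u).mark i := by
  unfold gatherView
  rw [gather_update hT ht]
  simp only [gather, Multiset.mem_map, Finset.mem_val, Network.mem_nbrs,
    exists_exists_and_eq_and]

variable {ℓ : N.V → List Bool} (hx : ∀ v, node (x v) = N.nodeInfo ℓ v)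

include hx

theorem gatherView_sound {T₀ : ℕ} (hT : ∀ v, T (x v) = T₀) {t : ℕ} (ht : t ≤ T₀) :
    ∀ v, (N.marked ℓ).Sound (gatherView node T fin N x t v) := by
  induction t with
  | zero =>
    refine fun v => ⟨fun i j h => h.elim, fun i h => ?_⟩
    change i = (node (x v)).id ∧ (node (x v)).label = [true] at h
    rw [hx] at h
    exact ⟨v, h.2, h.1.symm⟩
  | succ t ih =>
    intro v
    have ih := ih (by omega)
    constructor
    · intro i j h
      rw [gatherView_adj hT (by omega)] at h
      rcases h with h | ⟨u, hu, rfl, rfl⟩ | ⟨u, -, h⟩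
      · exact (ih v).1 i j h
      · rw [hx, hx]; exact ⟨v, u, hu, rfl, rfl⟩
      · exact (ih u).1 i j h
    · intro i h
      rw [gatherView_mark hT (by omega)] at h
      rcases h with h | ⟨u, -, h⟩
      · exact (ih v).2 i h
      · exact (ih u).2 i h

/-- The inequality `r < t` is strict because a node needs one round merely to learn the identifiers
of its neighbours. -/
theorem gatherView_known {T₀ : ℕ} (hT : ∀ v, T (x v) = T₀) {r : ℕ} :
    ∀ {t : ℕ}, r < t → t ≤ T₀ → ∀ v,
      (N.marked ℓ).Known (gatherView node T fin N x t v) r v := by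
  have own : ∀ {t : ℕ}, t ≤ T₀ → ∀ v, ℓ v = [true] →
      (gatherView node T fin N x t v).mark (N.id v) := by
    intro t
    induction t with
    | zero =>
      intro _ v h
      change N.id v = (node (x v)).id ∧ (node (x v)).label = [true]
      rw [hx]
      exact ⟨rfl, h⟩
    | succ t ih =>
      intro ht v h
      rw [gatherView_mark hT (by omega)]
      exact Or.inl (ih (by omega) v h)
  have base : ∀ {t : ℕ}, 0 < t → t ≤ T₀ → ∀ v,
      (N.marked ℓ).KnownAt (gatherView node T fin N x t v) v := by
    intro t h0 ht v
    refine ⟨own ht v, fun u hu => ?_⟩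
    obtain ⟨t, rfl⟩ := Nat.exists_eq_succ_of_ne_zero h0.ne'
    rw [Nat.succ_eq_add_one, gatherView_adj hT (by omega)]
    refine Or.inr (Or.inl ⟨u, hu, ?_⟩)
    rw [hx, hx]
    exact ⟨rfl, rfl⟩
  induction r with
  | zero => exact base
  | succ r ih =>
    intro t hr ht v
    refine MarkedGraph.known_succ.2 ⟨base (by omega) ht v, fun u hu => ?_⟩
    obtain ⟨t, rfl⟩ : ∃ s, t = s + 1 := ⟨t - 1, by omega⟩
    refine (ih (t := t) (by omega) (by omega) u).mono_right (fun i j h => ?_) (fun i h => ?_)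
    · rw [gatherView_adj hT (by omega)]
      exact Or.inr (Or.inr ⟨u, hu, h⟩)
    · rw [gatherView_mark hT (by omega)]
      exact Or.inr ⟨u, hu, h⟩

omit hx in
theorem gatherView_id {T₀ : ℕ} (hT : ∀ v, T (x v) = T₀) {t : ℕ} (ht : t ≤ T₀) (v : N.V) (i : ℕ) :
    (gatherView node T fin N x t v).id i = i := by
  cases t with
  | zero => rfl
  | succ t =>
    unfold gatherView
    rw [gather_update hT (by omega)]
    rfl

omit hx in
theorem gather_outputs {T₀ : ℕ} (hT : ∀ v, T (x v) = T₀) :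
    (gather node T fin).Outputs N x T₀ fun v => fin (x v) (gatherView node T fin N x T₀ v) := by
  intro v
  obtain ⟨h1, h2⟩ := gather_state (node := node) (fin := fin) hT le_rfl v
  change (if T _ ≤ _ then some (fin _ _) else none) = _
  rw [h1, h2, hT, if_pos le_rfl]
  rfl

/-- The colour decoded from the view of `v` is the one decoded from the whole network. -/
theorem color_gatherView {T₀ L : ℕ} (hT : ∀ v, T (x v) = T₀) (hr : 7 * L + 2 < T₀)
    (v : N.V) : (gatherView node T fin N x T₀ v).color L (N.id v) = (N.marked ℓ).color L v :=
  MarkedGraph.color_eq (gatherView_sound hx hT le_rfl v) N.id_injective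
    (gatherView_id hT le_rfl v) (gatherView_known hx hT (by omega) le_rfl v)

/-- The test whether the decoded colour of `v` differs from that of all neighbours can be carried
out in the view of `v`. -/
theorem proper_gatherView {T₀ L : ℕ} (hT : ∀ v, T (x v) = T₀) (hr : 7 * L + 3 < T₀) (v : N.V) :
    (∀ j, (gatherView node T fin N x T₀ v).adj (N.id v) j →
      (gatherView node T fin N x T₀ v).color L (N.id v) ≠
        (gatherView node T fin N x T₀ v).color L j) ↔
    ∀ u, N.graph.Adj v u → (N.marked ℓ).color L v ≠ (N.marked ℓ).color L u := by
  have hS := gatherView_sound (fin := fin) hx hT le_rfl v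
  have hK : (N.marked ℓ).Known _ (7 * L + 2 + 1) v :=
    gatherView_known (fin := fin) hx hT (by omega) le_rfl v
  have hW := gatherView_id (node := node) (fin := fin) hT le_rfl v
  have hv := MarkedGraph.color_eq hS N.id_injective hW hK.of_succ
  constructor
  · intro H u hu
    have h := H _ (hK.adj hu)
    have h' := MarkedGraph.color_eq hS N.id_injective hW (hK.next hu)
    exact fun e => h (hv.trans (e.trans h'.symm))
  · intro H j hj
    obtain ⟨u, hu, rfl⟩ := (MarkedGraph.adj_iff hS N.id_injective hK j).1 hj
    have h' := MarkedGraph.color_eq hS N.id_injective hW (hK.next hu)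
    exact fun e => H u hu (hv.symm.trans (e.trans h'))

end LocalAlgorithm

/-! ### Correctness of decoding for well-separated gadgets. -/

namespace SimpleGraph

variable {V : Type}

/-- There is a walk of length at most `k`. -/
def Within (H : SimpleGraph V) (k : ℕ) (u v : V) : Prop := ∃ p : H.Walk u v, p.length ≤ k

/-- There is a path of length `k` that starts at `v`. -/
def HasPathFrom (H : SimpleGraph V) (k : ℕ) (v : V) : Prop :=
  ∃ (u : V) (p : H.Walk v u), p.IsPath ∧ p.length = k

/-- `u` and `v` are at distance at most `2`. -/
def Near (G : SimpleGraph V) (u v : V) : Prop :=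
  u = v ∨ G.Adj u v ∨ ∃ w, G.Adj u w ∧ G.Adj w v

theorem Near.symm {G : SimpleGraph V} {u v : V} (h : G.Near u v) : G.Near v u := by
  rcases h with h | h | ⟨w, h, h'⟩
  · exact Or.inl h.symm
  · exact Or.inr (Or.inl h.symm)
  · exact Or.inr (Or.inr ⟨w, h'.symm, h.symm⟩)

variable {H : SimpleGraph V}

theorem Within.symm {k : ℕ} {u v : V} : H.Within k u v → H.Within k v u :=
  fun ⟨p, hp⟩ => ⟨p.reverse, by simpa using hp⟩

theorem Within.trans {k l m : ℕ} {u v w : V} (h : H.Within k u v) (h' : H.Within l v w)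
    (hm : k + l ≤ m) : H.Within m u w := by
  obtain ⟨p, hp⟩ := h
  obtain ⟨q, hq⟩ := h'
  exact ⟨p.append q, by rw [Walk.length_append]; omega⟩

theorem Within.mono {k l : ℕ} (hkl : k ≤ l) {u v : V} : H.Within k u v → H.Within l u v :=
  fun ⟨p, hp⟩ => ⟨p, hp.trans hkl⟩

/-- If no path of length `k` starts at `v`, then the component of `v` is small. -/
theorem within_of_not_hasPathFrom {k : ℕ} {u v : V} (hv : ¬ H.HasPathFrom k v)
    (h : H.Reachable v u) : H.Within k v u := by
  classical
  obtain ⟨p⟩ := h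
  by_contra hk
  have hlen : k < p.bypass.length := by
    by_contra h
    exact hk ⟨p.bypass, by omega⟩
  exact hv ⟨_, p.bypass.take k, p.bypass_isPath.take k, by rw [Walk.take_length]; omega⟩

/-- The graph that remains when the nodes with colour `0` are isolated. -/
def rest (G : SimpleGraph V) (φ : V → Fin 3) : SimpleGraph V where
  Adj u v := G.Adj u v ∧ φ u ≠ 0 ∧ φ v ≠ 0
  symm := ⟨fun _ _ h => ⟨h.1.symm, h.2.2, h.2.1⟩⟩
  loopless := ⟨fun _ h => G.loopless.irrefl _ h.1⟩

/-- A node with two neighbours of colour `0`, or an edge without common neighbours of colour `0`;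
marking such a node or edge in addition to the nodes of colour `0` can be recognized. -/
def IsGadget (G : SimpleGraph V) (id : V → ℕ) (φ : V → Fin 3) (x y : V) : Prop :=
  φ x ≠ 0 ∧ φ y ≠ 0 ∧
    ((x = y ∧ ∃ a b, a ≠ b ∧ G.Adj x a ∧ G.Adj x b ∧ φ a = 0 ∧ φ b = 0) ∨
      (G.Adj x y ∧ id x < id y ∧ ∀ a, φ a = 0 → G.Adj x a → ¬ G.Adj y a))

section Decoding

variable {G : SimpleGraph V} {id : V → ℕ} {φ : V → Fin 3} {K : Type} {x y : K → V} {L : ℕ}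

/-- The nodes of colour `0` and the gadgets are marked. -/
def gadgetMarks (G : SimpleGraph V) (id : V → ℕ) (φ : V → Fin 3) (x y : K → V) :
    MarkedGraph V where
  adj := G.Adj
  mark v := φ v = 0 ∨ ∃ k, v = x k ∨ v = y k
  id := id

variable (hφ : ∀ u v, G.Adj u v → φ u ≠ φ v) (hmax : ∀ v, φ v ≠ 0 → ∃ a, G.Adj v a ∧ φ a = 0)
  (hg : ∀ k, G.IsGadget id φ (x k) (y k))
  (hfar : ∀ k l u v, (u = x k ∨ u = y k) → (v = x l ∨ v = y l) → G.Near u v → k = l)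

include hφ hmax hg hfar

/-- Two marked neighbours of a node of colour `0` would lie in one gadget by `hfar`, hence be the
two ends of an edge gadget, which have no common neighbour of colour `0`. Conversely, a single-node
gadget has two such neighbours by definition, and an end of an edge gadget has the other end and, by
`hmax`, a neighbour of colour `0`. -/
theorem extra_gadgetMarks (v : V) :
    (gadgetMarks G id φ x y).Extra v ↔ ∃ k, v = x k ∨ v = y k := by
  constructor
  · rintro ⟨hv | hv, a, b, hab, ha, hb, ma, mb⟩
    · exfalso
      change G.Adj v a at ha
      change G.Adj v b at hb
      have hma := ma.resolve_left fun h => hφ v a ha (hv.trans h.symm)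
      have hmb := mb.resolve_left fun h => hφ v b hb (hv.trans h.symm)
      obtain ⟨k, hk⟩ := hma
      obtain ⟨l, hl⟩ := hmb
      obtain rfl := hfar k l a b hk hl (Or.inr (Or.inr ⟨v, ha.symm, hb⟩))
      obtain ⟨-, -, ⟨hxy, -⟩ | ⟨-, -, h⟩⟩ := hg k
      · rw [← hxy, or_self] at hk hl
        exact hab (hk.trans hl.symm)
      · rcases hk with rfl | rfl <;> rcases hl with rfl | rfl
        · exact hab rfl
        · exact h v hv ha.symm hb.symm
        · exact h v hv hb.symm ha.symm
        · exact hab rfl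
    · exact hv
  · rintro ⟨k, hk⟩
    refine ⟨Or.inr ⟨k, hk⟩, ?_⟩
    obtain ⟨hx, hy, ⟨hxy, a, b, hab, ha, hb, ha0, hb0⟩ | ⟨hxy, -, -⟩⟩ := hg k
    · rw [← hxy, or_self] at hk
      subst hk
      exact ⟨a, b, hab, ha, hb, Or.inl ha0, Or.inl hb0⟩
    · rcases hk with rfl | rfl
      · obtain ⟨a, ha, ha0⟩ := hmax _ hx
        exact ⟨a, y k, fun h => hy (h ▸ ha0), ha, hxy, Or.inl ha0, Or.inr ⟨k, Or.inr rfl⟩⟩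
      · obtain ⟨a, ha, ha0⟩ := hmax _ hy
        exact ⟨a, x k, fun h => hx (h ▸ ha0), ha, hxy.symm, Or.inl ha0, Or.inr ⟨k, Or.inl rfl⟩⟩

theorem base_gadgetMarks (v : V) : (gadgetMarks G id φ x y).Base v ↔ φ v = 0 := by
  unfold MarkedGraph.Base
  rw [extra_gadgetMarks hφ hmax hg hfar]
  constructor
  · rintro ⟨h, h'⟩
    exact h.resolve_right h'
  · refine fun h => ⟨Or.inl h, ?_⟩
    rintro ⟨k, rfl | rfl⟩
    · exact (hg k).1 h
    · exact (hg k).2.1 h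

theorem reach_gadgetMarks (k : ℕ) : ∀ u v, (gadgetMarks G id φ x y).Reach k u v ↔
    ∃ p : (G.rest φ).Walk u v, p.length = k := by
  have hadj : ∀ u v, (gadgetMarks G id φ x y).RestAdj u v ↔ (G.rest φ).Adj u v := by
    intro u v
    unfold MarkedGraph.RestAdj
    rw [base_gadgetMarks hφ hmax hg hfar, base_gadgetMarks hφ hmax hg hfar]
    rfl
  induction k with
  | zero =>
    refine fun u v => ⟨?_, ?_⟩
    · rintro rfl
      exact ⟨Walk.nil, rfl⟩
    · rintro ⟨p, hp⟩
      exact Walk.eq_of_length_eq_zero hp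
  | succ k ih =>
    refine fun u v => ⟨?_, ?_⟩
    · rintro ⟨w, hw, hwv⟩
      obtain ⟨p, hp⟩ := (ih w v).1 hwv
      exact ⟨Walk.cons ((hadj u w).1 hw) p, by simp [hp]⟩
    · rintro ⟨p, hp⟩
      cases p with
      | nil => simp at hp
      | cons h p => exact ⟨_, (hadj _ _).2 h, (ih _ _).2 ⟨p, by simpa using hp⟩⟩

/-- By separation the only possible extra neighbour of `x k` is `y k`, whose identifier is larger.
-/
theorem root_gadgetMarks (v : V) : (gadgetMarks G id φ x y).Root v ↔ ∃ k, v = x k := by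
  unfold MarkedGraph.Root
  rw [extra_gadgetMarks hφ hmax hg hfar]
  constructor
  · rintro ⟨⟨k, rfl | rfl⟩, h⟩
    · exact ⟨k, rfl⟩
    · obtain ⟨-, -, ⟨hxy, -⟩ | ⟨hxy, hid, -⟩⟩ := hg k
      · exact ⟨k, hxy.symm⟩
      · have := h (x k) hxy.symm ((extra_gadgetMarks hφ hmax hg hfar _).2 ⟨k, Or.inl rfl⟩)
        exact absurd this hid.asymm
  · rintro ⟨k, rfl⟩
    refine ⟨⟨k, Or.inl rfl⟩, fun z hz hze => ?_⟩
    change G.Adj (x k) z at hz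
    obtain ⟨l, hl⟩ := (extra_gadgetMarks hφ hmax hg hfar _).1 hze
    obtain rfl := hfar k l (x k) z (Or.inl rfl) hl (Or.inr (Or.inl hz))
    rcases hl with rfl | rfl
    · exact absurd hz (G.loopless.irrefl _)
    · obtain ⟨-, -, ⟨hxy, -⟩ | ⟨-, hid, -⟩⟩ := hg k
      · rw [← hxy] at hz
        exact absurd hz (G.loopless.irrefl _)
      · exact hid

omit hmax hg hfar in
theorem even_length_iff {u v : V} (p : (G.rest φ).Walk u v) (hu : φ u ≠ 0) :
    (Even p.length ↔ φ v = φ u) ∧ φ v ≠ 0 := by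
  induction p with
  | nil => simpa using hu
  | @cons u w v h p ih =>
    obtain ⟨h1, h2⟩ := ih h.2.2
    refine ⟨?_, h2⟩
    rw [Walk.length_cons, Nat.even_add_one, h1]
    have := hφ _ _ h.1
    have h0 := h.2.2
    clear ih h1 h
    generalize φ u = a at *
    generalize φ v = b at *
    generalize φ w = c at *
    clear p hφ
    revert a b c
    decide

variable (hid : Function.Injective id)
  (hflip : ∀ k, (φ (x k) = 1 ∧ ∀ l, l ≠ k → ¬ (G.rest φ).Within (2 * L) (x k) (x l)) ∨
    (φ (x k) = 2 ∧ ∃ l, l ≠ k ∧ (G.rest φ).Within (2 * L) (x k) (x l)))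
  (hroot : ∀ v, (G.rest φ).HasPathFrom L v → ∃ k, (G.rest φ).Within (5 * L) v (x k))

include hid hflip

theorem flipped_gadgetMarks (k : K) :
    ¬ (gadgetMarks G id φ x y).Flipped L (x k) ↔ φ (x k) = 1 := by
  have key : (gadgetMarks G id φ x y).Flipped L (x k) ↔
      ∃ l, l ≠ k ∧ (G.rest φ).Within (2 * L) (x k) (x l) := by
    constructor
    · rintro ⟨n, hn, z, hz, hzr, hne⟩
      obtain ⟨l, rfl⟩ := (root_gadgetMarks hφ hmax hg hfar _).1 hzr
      obtain ⟨p, rfl⟩ := (reach_gadgetMarks hφ hmax hg hfar _ _ _).1 hz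
      exact ⟨l, fun h => hne (h ▸ rfl), p, hn⟩
    · rintro ⟨l, hl, p, hp⟩
      refine ⟨_, hp, x l, (reach_gadgetMarks hφ hmax hg hfar _ _ _).2 ⟨p, rfl⟩,
        (root_gadgetMarks hφ hmax hg hfar _).2 ⟨l, rfl⟩, fun h => hl ?_⟩
      exact hfar l k _ _ (Or.inl rfl) (Or.inl rfl) (Or.inl (hid h))
  rw [key]
  rcases hflip k with ⟨h1, h2⟩ | ⟨h1, h2⟩
  · simpa [h1] using h2
  · simpa [h1] using h2

/-- Every root in reach, along any walk, gives the correct answer, so it does not matter which one a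
node consults. -/
theorem rootSecond_gadgetMarks {v : V} (hv : φ v ≠ 0) (h : (gadgetMarks G id φ x y).HasRoot L v) :
    (gadgetMarks G id φ x y).RootSecond L v ↔ φ v = 1 := by
  have key : ∀ n z, (gadgetMarks G id φ x y).Reach n v z → (gadgetMarks G id φ x y).Root z →
      ((Even n ↔ ¬ (gadgetMarks G id φ x y).Flipped L z) ↔ φ v = 1) := by
    intro n z hn hz
    obtain ⟨k, rfl⟩ := (root_gadgetMarks hφ hmax hg hfar _).1 hz
    obtain ⟨p, rfl⟩ := (reach_gadgetMarks hφ hmax hg hfar _ _ _).1 hn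
    obtain ⟨h1, h2⟩ := even_length_iff hφ p hv
    rw [flipped_gadgetMarks hφ hmax hg hfar hid hflip, h1]
    generalize φ v = a at *
    generalize φ (x k) = b at *
    clear h1
    revert a b
    decide
  constructor
  · rintro ⟨n, hn, z, hz, hzr, h⟩
    exact (key n z hz hzr).1 h
  · obtain ⟨n, hn, z, hz, hzr⟩ := h
    exact fun h => ⟨n, hn, z, hz, hzr, (key n z hz hzr).2 h⟩

include hroot

-- The radius `5 * L` misses no root entirely: if a long path starts at `v`, then `hroot` provides a
-- root, and otherwise the whole component is within `L`.
omit hid hflip in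
theorem hasRoot_gadgetMarks (v : V) : (gadgetMarks G id φ x y).HasRoot L v ↔
    ∃ k, (G.rest φ).Reachable v (x k) := by
  constructor
  · rintro ⟨n, -, z, hz, hzr⟩
    obtain ⟨k, rfl⟩ := (root_gadgetMarks hφ hmax hg hfar _).1 hzr
    obtain ⟨p, -⟩ := (reach_gadgetMarks hφ hmax hg hfar _ _ _).1 hz
    exact ⟨k, ⟨p⟩⟩
  · rintro ⟨k, hk⟩
    have : ∃ k, (G.rest φ).Within (5 * L) v (x k) := by
      by_cases hv : (G.rest φ).HasPathFrom L v
      · exact hroot v hv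
      · exact ⟨k, (within_of_not_hasPathFrom hv hk).mono (by omega)⟩
    obtain ⟨k, p, hp⟩ := this
    exact ⟨_, hp, x k, (reach_gadgetMarks hφ hmax hg hfar _ _ _).2 ⟨p, rfl⟩,
      (root_gadgetMarks hφ hmax hg hfar _).2 ⟨k, rfl⟩⟩

-- By `hroot` a component without roots has no path of length `L`, so both endpoints see all of it.
-- They use the same minimum `m`, at distances of opposite parity.
omit hflip in
theorem minSecond_gadgetMarks {u v : V} (huv : (G.rest φ).Adj u v)
    (hu : ¬ (gadgetMarks G id φ x y).HasRoot L u) :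
    ¬ ((gadgetMarks G id φ x y).MinSecond L u ↔ (gadgetMarks G id φ x y).MinSecond L v) := by
  classical
  have hno : ∀ w, (G.rest φ).Reachable u w → ∀ z, (G.rest φ).Reachable w z →
      (G.rest φ).Within (5 * L) w z := by
    intro w hw z hz
    refine (within_of_not_hasPathFrom (k := L) (fun h => hu ?_) hz).mono (by omega)
    obtain ⟨k, p, -⟩ := hroot w h
    exact (hasRoot_gadgetMarks hφ hmax hg hfar hroot u).2 ⟨k, hw.trans ⟨p⟩⟩
  obtain ⟨m, hm, hmin⟩ : ∃ m, (G.rest φ).Reachable u m ∧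
      ∀ z, (G.rest φ).Reachable u z → id m ≤ id z := by
    have hex : ∃ n, ∃ m, (G.rest φ).Reachable u m ∧ id m = n := ⟨_, u, Reachable.refl u, rfl⟩
    obtain ⟨m, hm, hmn⟩ := Nat.find_spec hex
    exact ⟨m, hm, fun z hz => hmn.trans_le (Nat.find_min' hex ⟨z, hz, rfl⟩)⟩
  have key : ∀ w, (G.rest φ).Reachable u w → φ w ≠ 0 →
      ((gadgetMarks G id φ x y).MinSecond L w ↔ φ m = φ w) := by
    intro w hw hw0
    constructor
    · rintro ⟨n, hn, z, hz, heven, hzmin⟩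
      obtain ⟨p, rfl⟩ := (reach_gadgetMarks hφ hmax hg hfar _ _ _).1 hz
      obtain ⟨q, hq⟩ := hno w hw m (hw.symm.trans hm)
      have h1 := hzmin _ hq m ((reach_gadgetMarks hφ hmax hg hfar _ _ _).2 ⟨q, rfl⟩)
      have h2 := hmin z (hw.trans ⟨p⟩)
      obtain rfl : z = m := hid (le_antisymm h1 h2)
      exact (even_length_iff hφ p hw0).1.1 heven
    · intro h
      obtain ⟨q, hq⟩ := hno w hw m (hw.symm.trans hm)
      refine ⟨_, hq, m, (reach_gadgetMarks hφ hmax hg hfar _ _ _).2 ⟨q, rfl⟩,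
        (even_length_iff hφ q hw0).1.2 h, fun j _ z hz => ?_⟩
      obtain ⟨p, -⟩ := (reach_gadgetMarks hφ hmax hg hfar _ _ _).1 hz
      exact hmin z (hw.trans ⟨p⟩)
  obtain ⟨q⟩ := hm
  have hm0 := (even_length_iff hφ q huv.2.1).2
  rw [key u (Reachable.refl u) huv.2.1, key v huv.reachable huv.2.2]
  have h1 := hφ u v huv.1
  have h2 := huv.2.1
  have h3 := huv.2.2
  clear key hno
  generalize φ u = a at *
  generalize φ v = b at *
  generalize φ m = c at *
  clear hmin huv q hu hφ hmax hg hfar hroot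
  revert a b c
  decide

/-- The decoded colouring is proper. -/
theorem color_gadgetMarks_ne {u v : V} (huv : G.Adj u v) :
    (gadgetMarks G id φ x y).color L u ≠ (gadgetMarks G id φ x y).color L v := by
  unfold MarkedGraph.color
  rw [propext (base_gadgetMarks hφ hmax hg hfar u), propext (base_gadgetMarks hφ hmax hg hfar v)]
  have hne := hφ u v huv
  by_cases hu : φ u = 0
  · have hv : φ v ≠ 0 := fun h => hne (hu.trans h.symm)
    rw [if_pos hu, if_neg hv]
    split_ifs <;> decide
  by_cases hv : φ v = 0
  · rw [if_neg hu, if_pos hv]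
    split_ifs <;> decide
  rw [if_neg hu, if_neg hv]
  have hadj : (G.rest φ).Adj u v := ⟨huv, hu, hv⟩
  have hiff : (gadgetMarks G id φ x y).HasRoot L u ↔ (gadgetMarks G id φ x y).HasRoot L v := by
    rw [hasRoot_gadgetMarks hφ hmax hg hfar hroot,
      hasRoot_gadgetMarks hφ hmax hg hfar hroot]
    exact exists_congr fun k => ⟨hadj.symm.reachable.trans, hadj.reachable.trans⟩
  by_cases hr : (gadgetMarks G id φ x y).HasRoot L u
  · have hr' := hiff.1 hr
    have h1 := rootSecond_gadgetMarks hφ hmax hg hfar hid hflip hu hr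
    have h2 := rootSecond_gadgetMarks hφ hmax hg hfar hid hflip hv hr'
    have e1 : (gadgetMarks G id φ x y).Second L u ↔ φ u = 1 := by
      unfold MarkedGraph.Second; tauto
    have e2 : (gadgetMarks G id φ x y).Second L v ↔ φ v = 1 := by
      unfold MarkedGraph.Second; tauto
    rw [propext e1, propext e2]
    split_ifs with g1 g2 g2
    · exact absurd (g1.trans g2.symm) hne
    · decide
    · decide
    · omega
  · have hr' := mt hiff.2 hr
    have h := minSecond_gadgetMarks hφ hmax hg hfar hid hroot hadj hr
    have e1 : ¬ ((gadgetMarks G id φ x y).Second L u ↔ (gadgetMarks G id φ x y).Second L v) := by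
      unfold MarkedGraph.Second; tauto
    split_ifs with h1 h2 h2
    · exact absurd (iff_of_true h1 h2) e1
    · decide
    · decide
    · exact absurd (iff_of_false h1 h2) e1

end Decoding

end SimpleGraph

/-! ### Existence of gadgets, centres and marks. -/

namespace SimpleGraph

variable {V : Type} {G : SimpleGraph V} {id : V → ℕ} {φ : V → Fin 3} {D L m : ℕ}

open Classical in
theorem card_near_le [Fintype V] (hD : ∀ v, (Finset.univ.filter (G.Adj v)).card ≤ D) (v : V) :
    (Finset.univ.filter (G.Near v)).card ≤ 1 + D + D * D := by
  let B : V → Finset V := fun v => Finset.univ.filter (G.Adj v)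
  have hsub : Finset.univ.filter (G.Near v) ⊆ ({v} ∪ B v) ∪ (B v).biUnion B := by
    intro u hu
    simp only [Finset.mem_filter, Finset.mem_univ, true_and] at hu
    simp only [B, Finset.mem_union, Finset.mem_singleton, Finset.mem_filter, Finset.mem_univ,
      true_and, Finset.mem_biUnion]
    rcases hu with rfl | h | ⟨w, h⟩
    · exact Or.inl (Or.inl rfl)
    · exact Or.inl (Or.inr h)
    · exact Or.inr ⟨w, h⟩
  refine (Finset.card_le_card hsub).trans ((Finset.card_union_le _ _).trans ?_)
  refine Nat.add_le_add ((Finset.card_union_le _ _).trans ?_) ?_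
  · exact Nat.add_le_add (by simp) (hD v)
  · refine Finset.card_biUnion_le.trans ((Finset.sum_le_card_nsmul _ _ D fun u _ => hD u).trans ?_)
    rw [smul_eq_mul]
    exact Nat.mul_le_mul_right _ (hD v)

open Classical in
/-- A path with more than `D` nodes contains a gadget. -/
theorem exists_isGadget_of_path [Fintype V] (hid : Function.Injective id)
    (hD : ∀ v, (Finset.univ.filter (G.Adj v)).card ≤ D)
    (hmax : ∀ v, φ v ≠ 0 → ∃ a, G.Adj v a ∧ φ a = 0) (p : ℕ → V)
    (hp0 : ∀ i ≤ D, φ (p i) ≠ 0) (hadj : ∀ i < D, G.Adj (p i) (p (i + 1)))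
    (hinj : ∀ i ≤ D, ∀ j ≤ D, p i = p j → i = j) :
    ∃ i ≤ D, ∃ j ≤ D, G.IsGadget id φ (p i) (p j) := by
  by_contra! hno
  obtain ⟨a, ha, ha0⟩ := hmax (p 0) (hp0 0 (Nat.zero_le _))
  -- Without gadgets a path node has only one neighbour of colour `0`, and consecutive nodes share
  -- one. So `a` is passed along the path and gets `D + 1` neighbours.
  have key : ∀ i ≤ D, G.Adj (p i) a := by
    intro i
    induction i with
    | zero => exact fun _ => ha
    | succ i ih =>
      intro hi
      have hia := ih (by omega)
      have hpp := hadj i (by omega)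
      have h0 := hp0 i (by omega)
      have h1 := hp0 (i + 1) hi
      have hcommon : ∃ b, φ b = 0 ∧ G.Adj (p i) b ∧ G.Adj (p (i + 1)) b := by
        by_contra! hc
        rcases lt_or_gt_of_ne (fun h => hpp.ne (hid h) : id (p i) ≠ id (p (i + 1))) with h | h
        · exact hno i (by omega) (i + 1) hi ⟨h0, h1, Or.inr ⟨hpp, h, hc⟩⟩
        · exact hno (i + 1) hi i (by omega)
            ⟨h1, h0, Or.inr ⟨hpp.symm, h, fun b hb hb1 hb0 => hc b hb hb0 hb1⟩⟩
      obtain ⟨b, hb0, hib, hjb⟩ := hcommon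
      rcases eq_or_ne a b with rfl | hab
      · exact hjb
      · exact absurd ⟨h0, h0, Or.inl ⟨rfl, a, b, hab, hia, hib, ha0, hb0⟩⟩
          (hno i (by omega) i (by omega))
  have hcard : D + 1 ≤ (Finset.univ.filter (G.Adj a)).card := by
    rw [← Finset.card_range (D + 1)]
    refine Finset.card_le_card_of_injOn p (fun i hi => ?_) fun i hi j hj => ?_
    · simp only [Finset.coe_range, Set.mem_Iio] at hi
      simpa using (key i (by omega)).symm
    · simp only [Finset.coe_range, Set.mem_Iio] at hi hj
      exact hinj i (by omega) j (by omega)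
  have := hD a
  omega

/-- Near the start of a long path there are many disjoint gadgets, among them either enough whose
roots have colour `1`, or enough whose roots have colour `2`. -/
theorem exists_gadgets [Fintype V] (hid : Function.Injective id) (hD0 : 0 < D)
    (hD : ∀ v, (by classical exact (Finset.univ.filter (G.Adj v)).card) ≤ D)
    (hmax : ∀ v, φ v ≠ 0 → ∃ a, G.Adj v a ∧ φ a = 0) (hL : 3 * m * (D + 1) ≤ L) {c : V}
    (hc : (G.rest φ).HasPathFrom L c) (hm : 0 < m) :
    ∃ g : Bool × Fin m → V × V, (∀ q, G.IsGadget id φ (g q).1 (g q).2) ∧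
      (∀ q, (G.rest φ).Within L c (g q).1 ∧ (G.rest φ).Within L c (g q).2) ∧
      (∀ q r u, (u = (g q).1 ∨ u = (g q).2) → (u = (g r).1 ∨ u = (g r).2) → q = r) ∧
      ((∀ j, φ (g (false, j)).1 = 1) ∨ ∀ q, φ (g q).1 = 2) := by
  classical
  obtain ⟨e, p, hp, hlen⟩ := hc
  have hadj : ∀ i < L, (G.rest φ).Adj (p.getVert i) (p.getVert (i + 1)) := fun i hi =>
    p.adj_getVert_succ (by omega)
  have hinj : ∀ i ≤ L, ∀ j ≤ L, p.getVert i = p.getVert j → i = j := fun i hi j hj h =>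
    hp.getVert_injOn (by simp; omega) (by simp; omega) h
  have h0 : ∀ i ≤ L, φ (p.getVert i) ≠ 0 := by
    intro i hi
    have hLpos : 0 < L := by
      have : 0 < 3 * m * (D + 1) := by positivity
      omega
    rcases lt_or_eq_of_le hi with h | rfl
    · exact (hadj i h).2.1
    · have := (hadj (i - 1) (by omega)).2.2
      rwa [Nat.sub_add_cancel hLpos] at this
  have hwithin : ∀ i ≤ L, (G.rest φ).Within L c (p.getVert i) := fun i hi =>
    ⟨p.take i, by rw [Walk.take_length]; omega⟩
  -- The path is cut into `3 * m` disjoint blocks of `D + 1` nodes, each containing a gadget.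
  have hblock : ∀ b : Fin (3 * m), ∃ i ≤ D, ∃ j ≤ D,
      G.IsGadget id φ (p.getVert (b * (D + 1) + i)) (p.getVert (b * (D + 1) + j)) := by
    intro b
    have hb : b * (D + 1) + (D + 1) ≤ L := by
      have : (b + 1) * (D + 1) ≤ 3 * m * (D + 1) := Nat.mul_le_mul_right _ b.2
      linarith
    refine exists_isGadget_of_path hid (fun v => ?_) hmax (fun i => p.getVert (b * (D + 1) + i))
      (fun i hi => h0 _ (by omega)) (fun i hi => (hadj _ (by omega)).1) fun i hi j hj h => ?_
    · convert hD v
    · have := hinj _ (by omega) _ (by omega) h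
      omega
  choose s hs t ht hst using hblock
  have hle : ∀ (b : Fin (3 * m)) i, i ≤ D → b * (D + 1) + i ≤ L := by
    intro b i hi
    have : (b + 1) * (D + 1) ≤ 3 * m * (D + 1) := Nat.mul_le_mul_right _ b.2
    linarith
  have hdisj : ∀ (b b' : Fin (3 * m)) i i', i ≤ D → i' ≤ D →
      p.getVert (b * (D + 1) + i) = p.getVert (b' * (D + 1) + i') → b = b' := by
    intro b b' i i' hi hi' h
    have h := hinj _ (hle b i hi) _ (hle b' i' hi') h
    have h1 : (b * (D + 1) + i) / (D + 1) = b := by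
      rw [mul_comm, Nat.mul_add_div (by omega), Nat.div_eq_of_lt (by omega), add_zero]
    have h2 : (b' * (D + 1) + i') / (D + 1) = b' := by
      rw [mul_comm, Nat.mul_add_div (by omega), Nat.div_eq_of_lt (by omega), add_zero]
    exact Fin.ext (by rw [← h1, ← h2, h])
  let G' : Fin (3 * m) → V × V := fun b =>
    (p.getVert (b * (D + 1) + s b), p.getVert (b * (D + 1) + t b))
  -- If `m` roots have colour `1`, they form the list `false`, and the list `true` is filler of
  -- arbitrary colours. Otherwise at least `2 * m` roots have colour `2`, enough for both lists.
  obtain ⟨σ, hσ, hcol⟩ : ∃ σ : Bool × Fin m → Fin (3 * m), Function.Injective σ ∧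
      ((∀ j, φ (G' (σ (false, j))).1 = 1) ∨ ∀ q, φ (G' (σ q)).1 = 2) := by
    let good : Finset (Fin (3 * m)) := Finset.univ.filter fun b => φ (G' b).1 = 1
    by_cases hgood : m ≤ good.card
    · obtain ⟨A, hA, hAm⟩ := Finset.exists_subset_card_eq hgood
      have hB : m ≤ (Aᶜ).card := by
        rw [Finset.card_compl, Fintype.card_fin, hAm]; omega
      obtain ⟨f⟩ : Nonempty (Fin m ↪ A) :=
        Function.Embedding.nonempty_of_card_le (by simp [hAm])
      obtain ⟨f'⟩ : Nonempty (Fin m ↪ (Aᶜ : Finset _)) :=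
        Function.Embedding.nonempty_of_card_le (by rw [Fintype.card_coe]; simpa using hB)
      refine ⟨fun q => if q.1 then f' q.2 else f q.2, ?_, Or.inl fun j => ?_⟩
      · have hne : ∀ i j, (f i : Fin (3 * m)) ≠ f' j := fun i j h =>
          Finset.mem_compl.1 (f' j).2 (h ▸ (f i).2)
        rintro ⟨a, i⟩ ⟨b, j⟩ h
        cases a <;> cases b <;> simp only [if_true, Bool.false_eq_true, if_false] at h
        · rw [f.injective (Subtype.ext h)]
        · exact absurd h (hne _ _)
        · exact absurd h.symm (hne _ _)
        · rw [f'.injective (Subtype.ext h)]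
      · exact (Finset.mem_filter.1 (hA (f j).2)).2
    · have hB : 2 * m ≤ (goodᶜ).card := by
        rw [Finset.card_compl, Fintype.card_fin]; omega
      obtain ⟨f⟩ : Nonempty (Bool × Fin m ↪ (goodᶜ : Finset _)) :=
        Function.Embedding.nonempty_of_card_le (by rw [Fintype.card_coe]; simpa using hB)
      refine ⟨fun q => f q, fun q r h => f.injective (Subtype.ext h), Or.inr fun q => ?_⟩
      have h1 : φ (G' (f q)).1 ≠ 1 := fun h =>
        Finset.mem_compl.1 (f q).2 (Finset.mem_filter.2 ⟨Finset.mem_univ _, h⟩)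
      have h2 := (hst (f q)).1
      change φ (G' (f q)).1 ≠ 0 at h2
      change φ (G' (f q)).1 = 2
      omega
  refine ⟨fun q => G' (σ q), fun q => hst _, fun q => ⟨hwithin _ (hle _ _ (hs _)),
    hwithin _ (hle _ _ (ht _))⟩, fun q r u hq hr => hσ ?_, hcol⟩
  rcases hq with rfl | rfl <;> rcases hr with h | h
  · exact hdisj _ _ _ _ (hs _) (hs _) h
  · exact hdisj _ _ _ _ (hs _) (ht _) h
  · exact hdisj _ _ _ _ (ht _) (hs _) h
  · exact hdisj _ _ _ _ (ht _) (ht _) h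

/-- Well-separated centres such that every start of a long path is close to a centre. -/
theorem exists_centres [Finite V] (H : SimpleGraph V) (L : ℕ) :
    ∃ Z : Set V, (∀ c ∈ Z, H.HasPathFrom L c) ∧
      (∀ c ∈ Z, ∀ c' ∈ Z, H.Within (4 * L) c c' → c = c') ∧
      ∀ v, H.HasPathFrom L v → ∃ c ∈ Z, H.Within (4 * L) v c := by
  let P : Set V → Prop := fun Z => (∀ c ∈ Z, H.HasPathFrom L c) ∧
    ∀ c ∈ Z, ∀ c' ∈ Z, H.Within (4 * L) c c' → c = c'
  obtain ⟨Z, -, hZ⟩ := Finite.exists_le_maximal (p := P) (a := ∅) ⟨by simp, by simp⟩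
  refine ⟨Z, hZ.prop.1, hZ.prop.2, fun v hv => ?_⟩
  by_contra! hno
  have hP : P (insert v Z) := by
    refine ⟨?_, ?_⟩
    · rintro c (rfl | hc)
      · exact hv
      · exact hZ.prop.1 c hc
    · rintro c (rfl | hc) c' (rfl | hc') h
      · rfl
      · exact absurd h (hno c' hc')
      · exact absurd h.symm (hno c hc)
      · exact hZ.prop.2 c hc c' hc' h
  have hvZ : v ∈ Z := hZ.le_of_ge hP (Set.subset_insert v Z) (Set.mem_insert v Z)
  exact hno v hvZ ⟨Walk.nil, Nat.zero_le _⟩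

/-- A proper 3-colouring in which the nodes of colour `0` form a maximal independent set. -/
theorem exists_coloring_maximal [Fintype V] (h : G.Colorable 3) :
    ∃ φ : V → Fin 3, (∀ u v, G.Adj u v → φ u ≠ φ v) ∧
      ∀ v, φ v ≠ 0 → ∃ a, G.Adj v a ∧ φ a = 0 := by
  classical
  obtain ⟨φ₀⟩ := h
  let S : Finset (V → Fin 3) := Finset.univ.filter fun φ => ∀ u v, G.Adj u v → φ u ≠ φ v
  -- With the largest number of nodes of colour `0`, no further node can be recoloured to `0`.
  obtain ⟨φ, hφ, hmax⟩ := S.exists_max_image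
    (fun φ => (Finset.univ.filter fun v => φ v = 0).card)
    ⟨φ₀, Finset.mem_filter.2 ⟨Finset.mem_univ _, fun u v huv => φ₀.valid huv⟩⟩
  have hφ := (Finset.mem_filter.1 hφ).2
  refine ⟨φ, hφ, fun v hv => ?_⟩
  by_contra! hno
  have hψ : Function.update φ v 0 ∈ S := by
    refine Finset.mem_filter.2 ⟨Finset.mem_univ _, fun a b hab => ?_⟩
    rcases eq_or_ne a v with rfl | ha
    · rw [Function.update_self, Function.update_of_ne hab.ne.symm]
      exact (hno b hab).symm
    · rcases eq_or_ne b v with rfl | hb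
      · rw [Function.update_self, Function.update_of_ne ha]
        exact hno a hab.symm
      · rw [Function.update_of_ne ha, Function.update_of_ne hb]
        exact hφ a b hab
  refine absurd (hmax _ hψ) (not_le.2 (Finset.card_lt_card ⟨fun u hu => ?_, fun hsub => ?_⟩))
  · have hu := (Finset.mem_filter.1 hu).2
    refine Finset.mem_filter.2 ⟨Finset.mem_univ _, ?_⟩
    rw [Function.update_of_ne (fun h : u = v => hv (h ▸ hu)), hu]
  · have := hsub (Finset.mem_filter.2 ⟨Finset.mem_univ v, Function.update_self v 0 φ⟩)
    exact hv (Finset.mem_filter.1 this).2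

end SimpleGraph

/-- The path length that is used for networks of maximum degree at most `D`. -/
def pathLength (D : ℕ) : ℕ := 3 * (4 * (2 * (1 + D + D * D))) * (D + 1)

namespace SimpleGraph

/-- In a 3-colourable graph one can mark nodes such that the decoded colouring is proper. -/
theorem exists_marks {V : Type} [Fintype V] {G : SimpleGraph V} {id : V → ℕ} {D : ℕ}
    (hid : Function.Injective id) (hD0 : 0 < D)
    (hD : ∀ v, (by classical exact (Finset.univ.filter (G.Adj v)).card) ≤ D)
    (hG : G.Colorable 3) :
    ∃ mark : V → Prop, ∀ u v, G.Adj u v →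
      (MarkedGraph.mk G.Adj mark id).color (pathLength D) u ≠
        (MarkedGraph.mk G.Adj mark id).color (pathLength D) v := by
  classical
  obtain ⟨φ, hφ, hmax⟩ := exists_coloring_maximal hG
  set B := 1 + D + D * D with hB
  set L := pathLength D with hL
  obtain ⟨Z, hZpath, hZsep, hZcov⟩ := exists_centres (G.rest φ) L
  -- `B` bounds the number of nodes within distance two of a node. A gadget has at most two nodes
  -- and candidate gadgets are disjoint, hence `2 * B` conflicts per candidate and lists of length
  -- `4 * (2 * B)`.
  have hm : 0 < 4 * (2 * B) := by omega
  have hex := fun c : Z => exists_gadgets (m := 4 * (2 * B)) hid hD0 hD hmax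
    (le_of_eq (by rw [hL, hB]; rfl)) (hZpath c c.2) hm
  choose g hg hgL hgd hgc using hex
  have hmem : ∀ c q u, (u = (g c q).1 ∨ u = (g c q).2) → (G.rest φ).Within L c u := by
    rintro c q u (rfl | rfl)
    · exact (hgL c q).1
    · exact (hgL c q).2
  -- `L + 2 * L + L = 4 * L` is the separation of the centres, so roots of different centres are
  -- never within `2 * L`.
  have hcentre : ∀ {c c' : Z} {q q' u v k}, (u = (g c q).1 ∨ u = (g c q).2) →
      (v = (g c' q').1 ∨ v = (g c' q').2) → k ≤ 2 * L → (G.rest φ).Within k u v → c = c' := by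
    intro c c' q q' u v k hu hv hk h
    exact Subtype.ext (hZsep c c.2 c' c'.2 (((hmem c q u hu).trans h le_rfl).trans
      (hmem c' q' v hv).symm (by omega)))
  let pair : (Z × Bool) × Fin (4 * (2 * B)) → V × V := fun a => g a.1.1 (a.1.2, a.2)
  have hdisj : ∀ a b u, (u = (pair a).1 ∨ u = (pair a).2) → (u = (pair b).1 ∨ u = (pair b).2) →
      a = b := by
    rintro ⟨⟨c, s⟩, i⟩ ⟨⟨c', s'⟩, i'⟩ u ha hb
    obtain rfl : c = c' := hcentre (k := 0) ha hb (Nat.zero_le _) ⟨Walk.nil, le_rfl⟩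
    obtain ⟨rfl, rfl⟩ := Prod.mk.inj (hgd c (s, i) (s', i') u ha hb)
    rfl
  let C : (Z × Bool) × Fin (4 * (2 * B)) → (Z × Bool) × Fin (4 * (2 * B)) → Prop := fun a b =>
    ∃ u v, (u = (pair a).1 ∨ u = (pair a).2) ∧ (v = (pair b).1 ∨ v = (pair b).2) ∧ G.Near u v
  have hcard : ∀ a, (Finset.univ.filter (C a)).card ≤ 2 * B := by
    intro a
    have hw : ∀ b, ∃ v, C a b → (v = (pair b).1 ∨ v = (pair b).2) ∧
        (G.Near (pair a).1 v ∨ G.Near (pair a).2 v) := by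
      intro b
      by_cases h : C a b
      · obtain ⟨u, v, rfl | rfl, hv, huv⟩ := h
        · exact ⟨v, fun _ => ⟨hv, Or.inl huv⟩⟩
        · exact ⟨v, fun _ => ⟨hv, Or.inr huv⟩⟩
      · exact ⟨(pair b).1, fun h' => absurd h' h⟩
    choose w hw using hw
    have : (Finset.univ.filter (C a)).card ≤ (Finset.univ.filter (G.Near (pair a).1) ∪
        Finset.univ.filter (G.Near (pair a).2)).card := by
      refine Finset.card_le_card_of_injOn w (fun b hb => ?_) fun b hb b' hb' h => ?_
      · have hb := (Finset.mem_filter.1 (Finset.mem_coe.1 hb)).2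
        simpa using (hw b hb).2
      · have hb := (Finset.mem_filter.1 (Finset.mem_coe.1 hb)).2
        have hb' := (Finset.mem_filter.1 (Finset.mem_coe.1 hb')).2
        exact hdisj b b' (w b) (hw b hb).1 (h ▸ (hw b' hb').1)
    refine this.trans ((Finset.card_union_le _ _).trans ?_)
    have hD' : ∀ v, (Finset.univ.filter (G.Adj v)).card ≤ D := fun v => by convert hD v
    have h1 := card_near_le hD' (pair a).1
    have h2 := card_near_le hD' (pair a).2
    omega
  obtain ⟨f, hf⟩ := exists_independent_transversal le_rfl hm C
    (fun a b ⟨u, v, hu, hv, huv⟩ => ⟨v, u, hv, hu, huv.symm⟩)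
    (fun a => by convert hcard a)
  -- Every centre keeps its `false` gadget. The `true` gadget is kept only when all root candidates
  -- have colour `2`, as the signal for that colour; otherwise it is discarded.
  let K := {k : Z × Bool // k.2 = false ∨ ¬ ∀ j, φ (g k.1 (false, j)).1 = 1}
  let x : K → V := fun k => (pair (k.1, f k.1)).1
  let y : K → V := fun k => (pair (k.1, f k.1)).2
  refine ⟨(gadgetMarks G id φ x y).mark, fun u v huv =>
    color_gadgetMarks_ne (x := x) (y := y) hφ hmax (fun k => hg _ _) ?_ hid ?_ ?_ huv⟩
  · intro k l u v hu hv huv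
    by_contra hkl
    exact hf k.1 l.1 (fun h => hkl (Subtype.ext h)) ⟨u, v, hu, hv, huv⟩
  · rintro ⟨⟨c, s⟩, hk⟩
    by_cases hgood : ∀ j, φ (g c (false, j)).1 = 1
    · have hs : s = false := hk.resolve_right (not_not.2 hgood)
      subst hs
      refine Or.inl ⟨hgood _, ?_⟩
      rintro ⟨⟨c', s'⟩, hk'⟩ hne h
      obtain rfl : c = c' := hcentre (Or.inl rfl) (Or.inl rfl) le_rfl h
      have hs : s' = false := hk'.resolve_right (not_not.2 hgood)
      subst hs
      exact hne rfl
    · refine Or.inr ⟨((hgc c).resolve_left hgood) _, ⟨⟨(c, !s), Or.inr hgood⟩, ?_, ?_⟩⟩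
      · intro h
        have := congrArg (fun k : K => k.1.2) h
        simp at this
      · exact (hgL c _).1.symm.trans (hgL c _).1 (by omega)
  · intro v hv
    obtain ⟨c, hc, h⟩ := hZcov v hv
    -- `4 * L` to the centre and `L` to its root account for the decoding radius `5 * L`.
    exact ⟨⟨(⟨c, hc⟩, false), Or.inl rfl⟩, h.trans (hgL ⟨c, hc⟩ _).1 (by omega)⟩

end SimpleGraph

/-! ### One-bit labels, the advice schema and the verifier. -/

namespace Network

theorem card_filter_adj_le (N : Network) (v : N.V) :
    (by classical exact (Finset.univ.filter (N.graph.Adj v)).card) ≤ N.maxDegree := by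
  classical
  have h := N.graph.degree_le_maxDegree v
  rw [← SimpleGraph.card_neighborFinset_eq_degree, SimpleGraph.neighborFinset_eq_filter] at h
  unfold maxDegree
  convert h

/-- Marks as one-bit labels. -/
theorem exists_label (N : Network) (mark : N.V → Prop) :
    ∃ ℓ : N.V → List Bool, (∀ v, (ℓ v).length = 1) ∧ (∀ v, ℓ v = [true] ↔ mark v) ∧
      N.marked ℓ = ⟨N.graph.Adj, mark, N.id⟩ := by
  classical
  refine ⟨fun v => [decide (mark v)], fun v => rfl, fun v => by simp, ?_⟩
  unfold marked
  simp

/-- The colour that a node obtains from the labels. -/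
noncomputable def labelColor (N : Network) (ℓ : N.V → List Bool) (v : N.V) : Fin 3 :=
  if N.maxDegree ≤ 1 then if ℓ v = [true] then 0 else 1
  else (N.marked ℓ).color (pathLength N.maxDegree) v

/-- When the maximum degree is at most `1`, a power of it allows at most one round, too few for
decoding. The components are then single nodes or edges, and the bit is itself a colour: the end
with the smaller identifier is marked. -/
theorem exists_labelColor_ne {N : Network} (hN : N.graph.Colorable 3) :
    ∃ ℓ : N.V → List Bool, (∀ v, (ℓ v).length = 1) ∧
      ∀ u v, N.graph.Adj u v → N.labelColor ℓ u ≠ N.labelColor ℓ v := by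
  classical
  unfold labelColor
  by_cases h1 : N.maxDegree ≤ 1
  · simp only [if_pos h1]
    obtain ⟨ℓ, hlen, hℓ, -⟩ := N.exists_label fun v => ∀ u, N.graph.Adj v u → N.id v < N.id u
    refine ⟨ℓ, hlen, ?_⟩
    have huniq : ∀ u v w, N.graph.Adj u v → N.graph.Adj u w → v = w := by
      intro u v w hv hw
      have h := (N.card_filter_adj_le u).trans h1
      rw [Finset.card_le_one] at h
      exact h v (by simpa using hv) w (by simpa using hw)
    intro u v huv
    have hmark : ∀ u v, N.graph.Adj u v → (ℓ u = [true] ↔ N.id u < N.id v) := by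
      intro u v huv
      rw [hℓ]
      exact ⟨fun h => h v huv, fun h w hw => huniq u v w huv hw ▸ h⟩
    have hne : N.id u ≠ N.id v := fun h => huv.ne (N.id_injective h)
    rcases lt_or_gt_of_ne hne with h | h
    · rw [if_pos ((hmark u v huv).2 h), if_neg (mt (hmark v u huv.symm).1 h.asymm)]; decide
    · rw [if_neg (mt (hmark u v huv).1 h.asymm), if_pos ((hmark v u huv.symm).2 h)]; decide
  · simp only [if_neg h1]
    obtain ⟨mark, hmark⟩ := SimpleGraph.exists_marks N.id_injective (D := N.maxDegree) (by omega)
      N.card_filter_adj_le hN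
    obtain ⟨ℓ, hlen, -, hℓ⟩ := N.exists_label mark
    exact ⟨ℓ, hlen, by rwa [hℓ]⟩

end Network

/-- The left side is at most `168 * D ^ 5 + 2`, and `2 ^ 8 ≤ D ^ 8` absorbs the constants, whence
the exponent `13`. -/
theorem seven_mul_pathLength_lt {D : ℕ} (hD : 2 ≤ D) : 7 * pathLength D + 2 < D ^ 13 := by
  have h1 : 1 + D + D * D ≤ D ^ 3 := by nlinarith
  have h2 : D + 1 ≤ D ^ 2 := by nlinarith
  have h3 : (1 + D + D * D) * (D + 1) ≤ D ^ 3 * D ^ 2 := Nat.mul_le_mul h1 h2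
  have h4 : 2 ^ 8 ≤ D ^ 8 := Nat.pow_le_pow_left hD 8
  have h5 : 0 < D ^ 3 * D ^ 2 := by positivity
  have h6 : D ^ 13 = D ^ 8 * (D ^ 3 * D ^ 2) := by ring
  have h7 : pathLength D = 24 * ((1 + D + D * D) * (D + 1)) := by unfold pathLength; ring
  have h8 : 2 ^ 8 * (D ^ 3 * D ^ 2) ≤ D ^ 8 * (D ^ 3 * D ^ 2) := Nat.mul_le_mul_right _ h4
  omega

theorem exists_adviceSchema :
    ∃ (c : ℕ) (f : (N : Network) → N.V → List Bool),
      IsUniformAdviceSchema {N | N.graph.Colorable 3} threeColoring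
        (fun _ => 1) (fun Δ => Δ ^ c) f := by
  classical
  let f : (N : Network) → N.V → List Bool := fun N =>
    if h : N.graph.Colorable 3 then (Network.exists_labelColor_ne h).choose else fun _ => []
  have hf : ∀ N : Network, N.graph.Colorable 3 → (∀ v, (f N v).length = 1) ∧
      ∀ u v, N.graph.Adj u v → N.labelColor (f N) u ≠ N.labelColor (f N) v := by
    intro N h
    simp only [f, dif_pos h]
    exact (Network.exists_labelColor_ne h).choose_spec
  refine ⟨13, f, ⟨fun N hN v => ((hf N hN).1 v).le, ?_⟩, fun N hN v => (hf N hN).1 v⟩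
  let fin : LocalInfo → MarkedGraph ℕ → Fin 3 := fun info W =>
    if info.maxDegree ≤ 1 then if info.label = [true] then 0 else 1
    else W.color (pathLength info.maxDegree) info.id
  refine ⟨LocalAlgorithm.gather LocalInfo.toNodeInfo (fun info => info.maxDegree ^ 13) fin,
    fun N hN => ⟨N.labelColor (f N), ?_, (hf N hN).2⟩⟩
  have hT : ∀ v, (N.localInfo (f N) v).maxDegree ^ 13 = N.maxDegree ^ 13 := fun _ => rfl
  have hout := LocalAlgorithm.gather_outputs (node := LocalInfo.toNodeInfo) (fin := fin)
    (T := fun info => info.maxDegree ^ 13) (x := N.localInfo (f N)) hT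
  convert hout using 1
  funext v
  unfold Network.labelColor
  by_cases h1 : N.maxDegree ≤ 1
  · rw [if_pos h1]
    exact (if_pos h1).symm
  · rw [if_neg h1]
    refine ((if_neg h1).trans ?_).symm
    exact LocalAlgorithm.color_gatherView (node := LocalInfo.toNodeInfo)
      (x := N.localInfo (f N)) (ℓ := f N) (fin := fin) (L := pathLength N.maxDegree)
      (T := fun info => info.maxDegree ^ 13) (T₀ := N.maxDegree ^ 13) (fun _ => rfl) hT
      (seven_mul_pathLength_lt (by omega)) v

theorem hasLocallyCheckableProof_threeColorable (D : ℕ) :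
    HasLocallyCheckableProof {N | N.maxDegree ≤ D} (fun N => N.graph.Colorable 3) 1 := by
  classical
  -- The verifier knows only the bound `D`, which may be `0`, while `exists_marks` needs a positive
  -- one.
  obtain ⟨L, hL⟩ : ∃ L, L = pathLength (D + 1) := ⟨_, rfl⟩
  let fin : NodeInfo → MarkedGraph ℕ → Bool := fun info W =>
    decide (∀ j, W.adj info.id j → W.color L info.id ≠ W.color L j)
  let A := LocalAlgorithm.gather (fun info => info) (fun _ => 7 * L + 4) fin
  have hout : ∀ (N : Network) (p : N.V → List Bool), A.Outputs N (N.nodeInfo p) (7 * L + 4)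
      fun v => decide (∀ u, N.graph.Adj v u →
        (N.marked p).color L v ≠ (N.marked p).color L u) := by
    intro N p
    have hT : ∀ v : N.V, (fun _ : NodeInfo => 7 * L + 4) (N.nodeInfo p v) = 7 * L + 4 :=
      fun _ => rfl
    have h := LocalAlgorithm.gather_outputs (node := fun info => info) (fin := fin)
      (T := fun _ => 7 * L + 4) (x := N.nodeInfo p) hT
    convert h using 1
    funext v
    exact decide_eq_decide.2 (LocalAlgorithm.proper_gatherView (node := fun info => info)
      (x := N.nodeInfo p) (T := fun _ => 7 * L + 4) (fin := fin) (fun _ => rfl) hT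
      (by omega) v).symm
  refine ⟨A, 7 * L + 4, fun N hN => ⟨fun p => ⟨_, hout N p⟩, fun hcol => ?_,
    fun hcol p out h => ?_⟩⟩
  · obtain ⟨mark, hmark⟩ := SimpleGraph.exists_marks N.id_injective (D := D + 1) (by omega)
      (fun v => (N.card_filter_adj_le v).trans (Nat.le_succ_of_le hN)) hcol
    rw [← hL] at hmark
    obtain ⟨ℓ, hlen, -, hℓ⟩ := N.exists_label mark
    refine ⟨ℓ, hlen, ?_⟩
    convert hout N ℓ using 1
    funext v
    rw [hℓ]
    exact (decide_eq_true (hmark v)).symm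
  -- Any labels whatsoever decode to some map into `Fin 3`; if all nodes accept, it is a proper
  -- colouring.
  · by_contra! hno
    refine hcol ⟨SimpleGraph.Coloring.mk ((N.marked p).color L) fun {u v} huv => ?_⟩
    have h1 : out u = true := by simpa using hno u
    have h2 := Option.some.inj ((h u).symm.trans (hout N p u))
    rw [h1] at h2
    exact of_decide_eq_true h2.symm v huv

theorem mainTheorem5 :
    (∃ (c : ℕ) (f : (N : Network) → N.V → List Bool),
      IsUniformAdviceSchema {N | N.graph.Colorable 3} threeColoring
        (fun _ => 1) (fun Δ => Δ ^ c) f) ∧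
    (∀ D : ℕ, HasLocallyCheckableProof {N | N.maxDegree ≤ D}
      (fun N => N.graph.Colorable 3) 1) :=
  ⟨exists_adviceSchema, hasLocallyCheckableProof_threeColorable⟩
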